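/- Let $n\ge 1$. For a unit vector $u\in S^{n-1}\subset\mathbb{R}^n$ and a compact set $K\subset\mathbb{R}^n$, the Steiner symmetral $\mathcal S_uK$ is defined as follows: for $y\in u^\perp$ let $\ell_y=\{y+tu: t\in\mathbb{R}\}$; if $\ell_y\cap K=\emptyset$ then $\ell_y\cap\mathcal S_uK=\emptyset$; otherwise $\ell_y\cap\mathcal S_uK$ is the closed segment of $\ell_y$ centered at $y$ whose length is the one-dimensional Lebesgue measure of $\ell_y\cap K$ (the single point $y$ if this measure is zero). Let $F\subset S^{n-1}$ be a finite set and let $(u_m)_{m\ge1}$ be a sequence of vectors chosen from $F$. Then, for every compact set $K\subset\mathbb{R}^n$, the symmetrals \[ K_m=\mathcal S_{u_m}\cdots\mathcal S_{u_1}K \] are compact, and there is a compact set $L\subset\mathbb{R}^n$ such that $(K_m)$ converges to $L$ both in the Hausdorff distance and in symmetric difference, that is, $\lambda_n(K_m\,\triangle\,L)\to0$ as $m\to\infty$, where $\lambda_n$ is Lebesgue measure. Furthermore, for every $v\in F$ with $u_m=v$ for infinitely many $m$, the set $L$ is symmetric under the reflection at the hyperplane $v^\perp$. (If $K=\emptyset$,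 then $K_m=L=\emptyset$ for all $m$; the Hausdorff distance is $0$ between two empty sets and $+\infty$ between an empty and a nonempty set.) -/

import Mathlib

noncomputable section

/-- For `y` orthogonal to the unit vector `u`, the intersection of `K` with the line `ℓ_y` through
`y` parallel to `u`, in the arclength coordinate `t ↦ y + t • u`. -/
def lineSection {n : ℕ} (u : EuclideanSpace ℝ (Fin n)) (K : Set (EuclideanSpace ℝ (Fin n)))
    (y : EuclideanSpace ℝ (Fin n)) : Set ℝ :=
  {t : ℝ | y + t • u ∈ K}

/-- The Steiner symmetral of `K` along the direction `u` (a unit vector). For `y` orthogonal to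
`u`, the line `ℓ_y` misses the symmetral if it misses `K`; otherwise it meets the symmetral in the
closed segment centered at `y` whose length is the one-dimensional Lebesgue measure of
`ℓ_y ∩ K` (the single point `y` if that measure is zero). -/
def steinerSymmetral {n : ℕ} (u : EuclideanSpace ℝ (Fin n))
    (K : Set (EuclideanSpace ℝ (Fin n))) : Set (EuclideanSpace ℝ (Fin n)) :=
  {x | ∃ (y : EuclideanSpace ℝ (Fin n)) (t : ℝ), inner ℝ u y = 0 ∧ x = y + t • u ∧
    (lineSection u K y).Nonempty ∧
    ENNReal.ofReal (2 * |t|) ≤ MeasureTheory.volume (lineSection u K y)}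

/-- The iterated symmetrals: the `m`-th one is obtained from `K` by symmetrizing successively
along the first `m` directions `u 0, …, u (m - 1)` of the sequence, `u 0` first. -/
def iteratedSymmetral {n : ℕ} (u : ℕ → EuclideanSpace ℝ (Fin n))
    (K : Set (EuclideanSpace ℝ (Fin n))) : ℕ → Set (EuclideanSpace ℝ (Fin n))
  | 0 => K
  | m + 1 => steinerSymmetral (u m) (iteratedSymmetral u K m)

end

/-!
Steiner symmetrization along `u` acts on functions through their closed superlevel sets. On the
functions `E → [0, 1]` that are `1`-Lipschitz and vanish off a fixed ball (`IsProfile`) this action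
is well defined, because symmetrization is monotone, maps balls centered at the origin into
themselves, is continuous along decreasing families of compact sets
(`exists_notMem_steinerSymmetral_cthickening`) and satisfies `(S A)_δ ⊆ S (A_δ)` for parallel sets
(`cthickening_steinerSymmetral_subset`, the one-dimensional Brunn–Minkowski inequality). It is
nonexpansive for the supremum distance, and the profiles form a compact space by Arzelà–Ascoli.
The energy `∫ f(x) ‖x‖² dx` decreases strictly unless `f` is its own symmetral: by Fubini and the
layer-cake formula this reduces to the fact that a centered interval minimizes `∫ t² dt` among the
sets of given length.

These facts suffice for convergence (`exists_tendsto_of_energy`). Let `G` be a cluster point of the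
orbit. From a time at which the orbit is close to `G`, it stays close as long as only directions
whose symmetrization fixes `G` are used; so if some other direction were used infinitely often, the
first such use would lower the energy below its limit. Hence `G` is fixed by all directions used
infinitely often, the distance to `G` is eventually decreasing, and the orbit converges to `G`.

Start the orbit at a tent function whose superlevel set at level `1` is `K`, and let `L` be the
superlevel set of the limit at level `1`. It is its own symmetral along each direction used
infinitely often, hence symmetric. Uniform convergence puts `K_m` into small neighborhoods of `L`.
For the converse, the parallel volumes `|A_δ|` decrease under symmetrization; comparing with the
superlevel sets at levels slightly below `1`, which eventually contain `L`, gives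
`|L_δ| ≤ |(K_m)_{δ + ε}|` for all `m`, `δ ≥ 0` and `ε > 0` (`volume_cthickening_superlevel_le`).
A point of `L` far from `K_m` would contradict this, since then a parallel set of `K_m` would miss
a ball of fixed size in a parallel set of `L`; with `δ = 0` it bounds the symmetric difference.
-/

open MeasureTheory Metric Set Filter Topology
open scoped ENNReal BoundedContinuousFunction

section Lines

variable {n : ℕ} {u : EuclideanSpace ℝ (Fin n)} {A B : Set (EuclideanSpace ℝ (Fin n))}

/-! ### Sections by parallel lines -/

/-- The orthogonal projection of `x` to `uᗮ`, for a unit vector `u`: the base point of the line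
through `x` parallel to `u`. -/
noncomputable def lineBase (u x : EuclideanSpace ℝ (Fin n)) : EuclideanSpace ℝ (Fin n) :=
  x - inner ℝ u x • u

theorem lineBase_add_smul (u x : EuclideanSpace ℝ (Fin n)) :
    lineBase u x + inner ℝ u x • u = x := sub_add_cancel _ _

theorem inner_lineBase (hu : ‖u‖ = 1) (x : EuclideanSpace ℝ (Fin n)) :
    inner ℝ u (lineBase u x) = 0 := by
  simp [lineBase, inner_sub_right, inner_smul_right, hu]

theorem inner_add_smul (hu : ‖u‖ = 1) {y : EuclideanSpace ℝ (Fin n)} (hy : inner ℝ u y = 0)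
    (t : ℝ) : inner ℝ u (y + t • u) = t := by
  simp [inner_add_right, inner_smul_right, hu, hy]

theorem lineBase_of_add_smul (hu : ‖u‖ = 1) {y : EuclideanSpace ℝ (Fin n)}
    (hy : inner ℝ u y = 0) (t : ℝ) : lineBase u (y + t • u) = y := by
  simp [lineBase, inner_add_smul hu hy]

theorem lineBase_sub (u x y : EuclideanSpace ℝ (Fin n)) :
    lineBase u (x - y) = lineBase u x - lineBase u y := by
  simp only [lineBase, inner_sub_right, sub_smul]; abel

theorem norm_sq_add_smul (hu : ‖u‖ = 1) {y : EuclideanSpace ℝ (Fin n)} (hy : inner ℝ u y = 0)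
    (t : ℝ) : ‖y + t • u‖ ^ 2 = ‖y‖ ^ 2 + t ^ 2 := by
  rw [norm_add_sq_real, inner_smul_right, real_inner_comm, hy, norm_smul, hu]
  simp

theorem norm_sq_lineBase (hu : ‖u‖ = 1) (x : EuclideanSpace ℝ (Fin n)) :
    ‖x‖ ^ 2 = ‖lineBase u x‖ ^ 2 + inner ℝ u x ^ 2 := by
  conv_lhs => rw [← lineBase_add_smul u x]
  exact norm_sq_add_smul hu (inner_lineBase hu x) _

theorem norm_lineBase_le (hu : ‖u‖ = 1) (x : EuclideanSpace ℝ (Fin n)) :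
    ‖lineBase u x‖ ≤ ‖x‖ := by
  have := norm_sq_lineBase hu x
  exact (sq_le_sq₀ (norm_nonneg _) (norm_nonneg _)).1 (by nlinarith [sq_nonneg (inner ℝ u x)])

theorem continuous_line (u y : EuclideanSpace ℝ (Fin n)) :
    Continuous fun t : ℝ => y + t • u := by fun_prop

theorem isometry_line (hu : ‖u‖ = 1) (y : EuclideanSpace ℝ (Fin n)) :
    Isometry fun t : ℝ => y + t • u := by
  refine Isometry.of_dist_eq fun s t => ?_
  rw [dist_add_left, dist_eq_norm, ← sub_smul, norm_smul, hu, mul_one, Real.dist_eq,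
    Real.norm_eq_abs]

theorem lineSection_mono (h : A ⊆ B) (y : EuclideanSpace ℝ (Fin n)) :
    lineSection u A y ⊆ lineSection u B y := fun _ ht => h ht

theorem isCompact_lineSection (hu : ‖u‖ = 1) (hA : IsCompact A)
    (y : EuclideanSpace ℝ (Fin n)) : IsCompact (lineSection u A y) :=
  (isometry_line hu y).isClosedEmbedding.isCompact_preimage hA

theorem mem_steinerSymmetral_iff (hu : ‖u‖ = 1) {x : EuclideanSpace ℝ (Fin n)} :
    x ∈ steinerSymmetral u A ↔ (lineSection u A (lineBase u x)).Nonempty ∧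
      ENNReal.ofReal (2 * |inner ℝ u x|) ≤ volume (lineSection u A (lineBase u x)) := by
  constructor
  · rintro ⟨y, t, hy, rfl, h1, h2⟩
    rw [lineBase_of_add_smul hu hy, inner_add_smul hu hy]
    exact ⟨h1, h2⟩
  · rintro ⟨h1, h2⟩
    exact ⟨_, _, inner_lineBase hu x, (lineBase_add_smul u x).symm, h1, h2⟩

theorem add_smul_mem_steinerSymmetral_iff (hu : ‖u‖ = 1) {y : EuclideanSpace ℝ (Fin n)}
    (hy : inner ℝ u y = 0) {t : ℝ} :
    y + t • u ∈ steinerSymmetral u A ↔ (lineSection u A y).Nonempty ∧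
      ENNReal.ofReal (2 * |t|) ≤ volume (lineSection u A y) := by
  rw [mem_steinerSymmetral_iff hu, lineBase_of_add_smul hu hy, inner_add_smul hu hy]

theorem steinerSymmetral_mono (h : A ⊆ B) : steinerSymmetral u A ⊆ steinerSymmetral u B := by
  rintro x ⟨y, t, hy, rfl, h1, h2⟩
  exact ⟨y, t, hy, rfl, h1.mono (lineSection_mono h y),
    h2.trans (measure_mono (lineSection_mono h y))⟩

theorem steinerSymmetral_empty : steinerSymmetral u ∅ = ∅ := by
  ext x; simp [steinerSymmetral, lineSection]

/-- The section of the symmetral of a compact set is a centered interval of the same length. -/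
theorem lineSection_steinerSymmetral (hu : ‖u‖ = 1) (hA : IsCompact A)
    {y : EuclideanSpace ℝ (Fin n)} (hy : inner ℝ u y = 0) (hne : (lineSection u A y).Nonempty) :
    lineSection u (steinerSymmetral u A) y =
      Icc (-((volume (lineSection u A y)).toReal / 2))
        ((volume (lineSection u A y)).toReal / 2) := by
  ext t
  have hfin : volume (lineSection u A y) ≠ ∞ := (isCompact_lineSection hu hA y).measure_lt_top.ne
  rw [lineSection, mem_ofPred_eq, add_smul_mem_steinerSymmetral_iff hu hy, mem_Icc, ← abs_le,
    ENNReal.ofReal_le_iff_le_toReal hfin]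
  constructor
  · rintro ⟨_, h⟩; linarith
  · intro h; exact ⟨hne, by linarith⟩

theorem lineSection_steinerSymmetral_of_empty (hu : ‖u‖ = 1)
    {y : EuclideanSpace ℝ (Fin n)} (hy : inner ℝ u y = 0) (hne : lineSection u A y = ∅) :
    lineSection u (steinerSymmetral u A) y = ∅ := by
  ext t
  rw [lineSection, mem_ofPred_eq, add_smul_mem_steinerSymmetral_iff hu hy, hne]
  simp

theorem volume_lineSection_steinerSymmetral (hu : ‖u‖ = 1) (hA : IsCompact A)
    {y : EuclideanSpace ℝ (Fin n)} (hy : inner ℝ u y = 0) :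
    volume (lineSection u (steinerSymmetral u A) y) = volume (lineSection u A y) := by
  rcases (lineSection u A y).eq_empty_or_nonempty with h | h
  · rw [lineSection_steinerSymmetral_of_empty hu hy h, h]
  · have hfin : volume (lineSection u A y) ≠ ∞ :=
      (isCompact_lineSection hu hA y).measure_lt_top.ne
    rw [lineSection_steinerSymmetral hu hA hy h, Real.volume_Icc, sub_neg_eq_add, add_halves,
      ENNReal.ofReal_toReal hfin]

/-- Upper semicontinuity of line sections of a compact set, jointly in the base point and in the
set: nearby sections of a thickening lie in a thickening of the section. -/
theorem exists_lineSection_cthickening_subset (hu : ‖u‖ = 1) (hA : IsCompact A)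
    (y : EuclideanSpace ℝ (Fin n)) {η : ℝ} (hη : 0 < η) :
    ∃ ε > 0, ∀ y', dist y' y < ε →
      lineSection u (cthickening ε A) y' ⊆ thickening η (lineSection u A y) := by
  have hZ : IsClosed ((fun t : ℝ => y + t • u) '' (thickening η (lineSection u A y))ᶜ) :=
    (isometry_line hu y).isClosedEmbedding.isClosedMap _ isOpen_thickening.isClosed_compl
  have hd : Disjoint A ((fun t : ℝ => y + t • u) '' (thickening η (lineSection u A y))ᶜ) := by
    rw [Set.disjoint_left]
    rintro _ hx ⟨t, ht, rfl⟩
    exact ht (self_subset_thickening hη _ hx)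
  obtain ⟨δ, hδ, hdisj⟩ := hd.exists_cthickenings hA hZ
  refine ⟨δ, hδ, fun y' hy' t ht => ?_⟩
  by_contra hcon
  refine Set.disjoint_left.1 hdisj ht (mem_cthickening_of_dist_le _ (y + t • u) _ _
    (mem_image_of_mem _ hcon) ?_)
  rw [dist_add_right]
  exact hy'.le

/-- The symmetrals of the thickenings of a compact set decrease to its symmetral, uniformly near
each point outside it. -/
theorem exists_notMem_steinerSymmetral_cthickening (hu : ‖u‖ = 1) (hA : IsCompact A)
    {x : EuclideanSpace ℝ (Fin n)} (hx : x ∉ steinerSymmetral u A) :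
    ∃ ε > 0, ∀ x', dist x' x < ε → x' ∉ steinerSymmetral u (cthickening ε A) := by
  have hcpt := isCompact_lineSection hu hA (lineBase u x)
  have hbase : ∀ x', dist (lineBase u x') (lineBase u x) ≤ dist x' x := fun x' => by
    rw [dist_eq_norm, dist_eq_norm, ← lineBase_sub]
    exact norm_lineBase_le hu _
  rcases (lineSection u A (lineBase u x)).eq_empty_or_nonempty with h | h
  · obtain ⟨ε, hε, H⟩ := exists_lineSection_cthickening_subset hu hA (lineBase u x) one_pos
    refine ⟨ε, hε, fun x' hx' hmem => ?_⟩
    have h1 := H _ ((hbase x').trans_lt hx')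
    rw [h, thickening_empty, subset_empty_iff] at h1
    exact ((mem_steinerSymmetral_iff hu).1 hmem).1.ne_empty h1
  · have hlt : volume (lineSection u A (lineBase u x)) < ENNReal.ofReal (2 * |inner ℝ u x|) := by
      by_contra hcon
      exact hx ((mem_steinerSymmetral_iff hu).2 ⟨h, not_lt.1 hcon⟩)
    have hlim := tendsto_measure_cthickening_of_isCompact (μ := volume) hcpt
    obtain ⟨c, hc1, hc2⟩ := exists_between hlt
    have hev : ∀ᶠ η in 𝓝[>] (0 : ℝ),
        volume (cthickening η (lineSection u A (lineBase u x))) < c :=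
      (hlim.mono_left nhdsWithin_le_nhds).eventually (gt_mem_nhds hc1)
    obtain ⟨η, hη, hη0⟩ := (hev.and self_mem_nhdsWithin).exists
    obtain ⟨ε, hε, H⟩ := exists_lineSection_cthickening_subset hu hA (lineBase u x) hη0
    have hcont : Continuous fun x' : EuclideanSpace ℝ (Fin n) =>
        ENNReal.ofReal (2 * |inner ℝ u x'|) :=
      ENNReal.continuous_ofReal.comp (by fun_prop)
    obtain ⟨ε', hε', H'⟩ := Metric.eventually_nhds_iff.1
      (hcont.continuousAt.eventually (lt_mem_nhds hc2))
    refine ⟨min ε ε', lt_min hε hε', fun x' hx' hmem => ?_⟩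
    have h1 := H _ ((hbase x').trans_lt (hx'.trans_le (min_le_left _ _)))
    have h2 := H' (hx'.trans_le (min_le_right _ _))
    have h3 := ((mem_steinerSymmetral_iff hu).1 hmem).2
    refine absurd (h3.trans (measure_mono ?_)) (h2.trans' hη).not_ge
    exact (lineSection_mono (cthickening_mono (min_le_left _ _) _) _).trans
      (h1.trans (thickening_subset_cthickening _ _))

theorem isClosed_steinerSymmetral (hu : ‖u‖ = 1) (hA : IsCompact A) :
    IsClosed (steinerSymmetral u A) := by
  rw [← isOpen_compl_iff, Metric.isOpen_iff]
  intro x hx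
  obtain ⟨ε, hε, H⟩ := exists_notMem_steinerSymmetral_cthickening hu hA hx
  exact ⟨ε, hε, fun x' hx' hmem =>
    H x' hx' (steinerSymmetral_mono (self_subset_cthickening A) hmem)⟩

theorem steinerSymmetral_subset_closedBall (hu : ‖u‖ = 1) {ρ : ℝ} (hA : A ⊆ closedBall 0 ρ) :
    steinerSymmetral u A ⊆ closedBall 0 ρ := by
  rintro x hx
  obtain ⟨⟨s, hs⟩, h⟩ := (mem_steinerSymmetral_iff hu).1 hx
  have hy := inner_lineBase hu x
  set y := lineBase u x
  have hρ : 0 ≤ ρ := (norm_nonneg _).trans (mem_closedBall_zero_iff.1 (hA hs))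
  have key : ∀ t ∈ lineSection u A y, ‖y‖ ^ 2 + t ^ 2 ≤ ρ ^ 2 := fun t ht => by
    rw [← norm_sq_add_smul hu hy]
    exact pow_le_pow_left₀ (norm_nonneg _) (mem_closedBall_zero_iff.1 (hA ht)) 2
  have hnn : 0 ≤ ρ ^ 2 - ‖y‖ ^ 2 := by nlinarith [key s hs, sq_nonneg s]
  have hsub : lineSection u A y ⊆
      Icc (-√(ρ ^ 2 - ‖y‖ ^ 2)) √(ρ ^ 2 - ‖y‖ ^ 2) := fun t ht =>
    abs_le.1 (Real.abs_le_sqrt (by linarith [key t ht]))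
  have h2 := h.trans (measure_mono hsub)
  rw [Real.volume_Icc, ENNReal.ofReal_le_ofReal_iff
    (by linarith [Real.sqrt_nonneg (ρ ^ 2 - ‖y‖ ^ 2)])] at h2
  have h3 : inner ℝ u x ^ 2 ≤ ρ ^ 2 - ‖y‖ ^ 2 := by
    rw [← Real.sq_sqrt hnn, ← sq_abs]
    exact pow_le_pow_left₀ (abs_nonneg _) (by linarith) 2
  rw [mem_closedBall_zero_iff, ← sq_le_sq₀ (norm_nonneg _) hρ, norm_sq_lineBase hu]
  linarith

theorem isCompact_steinerSymmetral (hu : ‖u‖ = 1) (hA : IsCompact A) :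
    IsCompact (steinerSymmetral u A) := by
  obtain ⟨ρ, hρ⟩ := hA.isBounded.subset_closedBall 0
  exact (isCompact_closedBall 0 ρ).of_isClosed_subset (isClosed_steinerSymmetral hu hA)
    (steinerSymmetral_subset_closedBall hu hρ)

theorem reflection_image_steinerSymmetral :
    (Submodule.span ℝ {u})ᗮ.reflection '' steinerSymmetral u A = steinerSymmetral u A := by
  have key : ∀ x ∈ steinerSymmetral u A,
      (Submodule.span ℝ {u})ᗮ.reflection x ∈ steinerSymmetral u A := by
    rintro _ ⟨y, t, hy, rfl, h1, h2⟩
    refine ⟨y, -t, hy, ?_, h1, by rwa [abs_neg]⟩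
    rw [map_add, map_smul, Submodule.reflection_orthogonalComplement_singleton_eq_neg,
      Submodule.reflection_mem_subspace_eq_self
        (Submodule.mem_orthogonal_singleton_iff_inner_right.2 hy)]
    simp
  refine Subset.antisymm (image_subset_iff.2 key) fun x hx => ⟨_, key x hx, ?_⟩
  exact Submodule.reflection_reflection _ x

/-! ### Thickenings -/

/-- The one-dimensional Brunn–Minkowski inequality for a compact set and an interval. -/
theorem volume_add_le_volume_cthickening {C : Set ℝ} (hC : IsCompact C) (hne : C.Nonempty) {s : ℝ}
    (hs : 0 ≤ s) : volume C + ENNReal.ofReal (2 * s) ≤ volume (cthickening s C) := by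
  obtain ⟨a, ha, hamin⟩ := hC.exists_isLeast hne
  obtain ⟨b, hb, hbmax⟩ := hC.exists_isGreatest hne
  have h1 : volume (C ∪ Ioc b (b + s)) = volume C + ENNReal.ofReal s := by
    rw [measure_union _ measurableSet_Ioc, Real.volume_Ioc, add_sub_cancel_left]
    exact Set.disjoint_left.2 fun x hx hx' => (hbmax hx).not_gt hx'.1
  have h2 : volume ((C ∪ Ioc b (b + s)) ∪ Ico (a - s) a) =
      volume C + ENNReal.ofReal s + ENNReal.ofReal s := by
    rw [measure_union _ measurableSet_Ico, Real.volume_Ico, sub_sub_cancel, h1]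
    refine Set.disjoint_left.2 ?_
    rintro x (hx | hx) hx'
    · exact (hamin hx).not_gt hx'.2
    · exact ((hamin hb).trans_lt hx.1).not_gt hx'.2
  rw [two_mul, ENNReal.ofReal_add hs hs, ← add_assoc, ← h2]
  refine measure_mono ?_
  rintro x ((hx | hx) | hx)
  · exact self_subset_cthickening _ hx
  · refine mem_cthickening_of_dist_le x b _ _ hb ?_
    rw [Real.dist_eq, abs_le]; constructor <;> linarith [hx.1, hx.2]
  · refine mem_cthickening_of_dist_le x a _ _ ha ?_
    rw [Real.dist_eq, abs_le]; constructor <;> linarith [hx.1, hx.2]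

/-- Symmetrizing after thickening gives more than thickening after symmetrizing. -/
theorem cthickening_steinerSymmetral_subset (hu : ‖u‖ = 1) (hA : IsCompact A) {δ : ℝ} (hδ : 0 ≤ δ) :
    cthickening δ (steinerSymmetral u A) ⊆ steinerSymmetral u (cthickening δ A) := by
  rw [(isCompact_steinerSymmetral hu hA).cthickening_eq_biUnion_closedBall hδ]
  intro x' hx'
  simp only [mem_iUnion, mem_closedBall] at hx'
  obtain ⟨x, hx, hd⟩ := hx'
  obtain ⟨hne, h⟩ := (mem_steinerSymmetral_iff hu).1 hx
  rw [dist_eq_norm] at hd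
  have hsq : ‖lineBase u x' - lineBase u x‖ ^ 2 + (inner ℝ u x' - inner ℝ u x) ^ 2 ≤ δ ^ 2 := by
    rw [← lineBase_sub, ← inner_sub_right, ← norm_sq_lineBase hu]
    exact pow_le_pow_left₀ (norm_nonneg _) hd 2
  set s : ℝ := |inner ℝ u x' - inner ℝ u x|
  have hperp : inner ℝ u (lineBase u x' - lineBase u x) = 0 := by
    rw [← lineBase_sub, inner_lineBase hu]
  have hcpt := isCompact_lineSection hu hA (lineBase u x)
  have hsub : cthickening s (lineSection u A (lineBase u x)) ⊆
      lineSection u (cthickening δ A) (lineBase u x') := by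
    rw [hcpt.cthickening_eq_biUnion_closedBall (abs_nonneg _)]
    intro τ' hτ'
    simp only [mem_iUnion, mem_closedBall] at hτ'
    obtain ⟨τ, hτ, hd'⟩ := hτ'
    refine mem_cthickening_of_dist_le _ (lineBase u x + τ • u) _ _ hτ ?_
    rw [dist_eq_norm, ← sq_le_sq₀ (norm_nonneg _) hδ, add_sub_add_comm, ← sub_smul,
      norm_sq_add_smul hu hperp]
    rw [Real.dist_eq] at hd'
    have := pow_le_pow_left₀ (abs_nonneg _) hd' 2
    rw [sq_abs, sq_abs] at this
    linarith
  refine (mem_steinerSymmetral_iff hu).2 ⟨(hne.mono (self_subset_cthickening _)).mono hsub, ?_⟩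
  refine le_trans ?_ ((volume_add_le_volume_cthickening hcpt hne (abs_nonneg _)).trans
    (measure_mono hsub))
  refine le_trans ?_ (add_le_add_left h _)
  rw [← ENNReal.ofReal_add (by positivity) (by positivity)]
  refine ENNReal.ofReal_le_ofReal ?_
  have := abs_sub_abs_le_abs_sub (inner ℝ u x') (inner ℝ u x)
  linarith

end Lines

section Fubini

variable {n : ℕ} {u : EuclideanSpace ℝ (Fin n)} {A B : Set (EuclideanSpace ℝ (Fin n))}

/-! ### Volume and second moment of a symmetral -/

/-- The coordinates `(y, t) ↦ y + t • u` with `y ∈ uᗮ` preserve volume. -/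
theorem measurePreserving_line_coordinates (hu : ‖u‖ = 1) :
    MeasurePreserving (fun p : (Submodule.span ℝ {u})ᗮ × ℝ =>
      (p.1 : EuclideanSpace ℝ (Fin n)) + p.2 • u) := by
  have h1 := ((Submodule.span ℝ {u}).orthogonalDecomposition.symm).measurePreserving
  have h2 := WithLp.volume_preserving_toLp (Submodule.span ℝ {u}) (Submodule.span ℝ {u})ᗮ
  have h3 := (LinearIsometryEquiv.toSpanUnitSingleton u hu (𝕜 := ℝ)).measurePreserving
  have h4 := h3.prod (MeasurePreserving.id (volume : Measure (Submodule.span ℝ {u})ᗮ))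
  have h5 : MeasurePreserving (Prod.swap : (Submodule.span ℝ {u})ᗮ × ℝ → _) volume volume :=
    Measure.measurePreserving_swap
  have h6 := (h1.comp h2).comp (h4.comp h5)
  have e : (fun p : (Submodule.span ℝ {u})ᗮ × ℝ =>
      (p.1 : EuclideanSpace ℝ (Fin n)) + p.2 • u) =
      ((Submodule.span ℝ {u}).orthogonalDecomposition.symm ∘ WithLp.toLp 2) ∘
        (Prod.map (LinearIsometryEquiv.toSpanUnitSingleton u hu) id ∘ Prod.swap) := by
    ext1 p
    simp [Submodule.orthogonalDecomposition_symm_apply, add_comm]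
  rw [e]
  exact h6

theorem lintegral_eq_lintegral_lines (hu : ‖u‖ = 1) {g : EuclideanSpace ℝ (Fin n) → ℝ≥0∞}
    (hg : Measurable g) :
    ∫⁻ x, g x = ∫⁻ y : (Submodule.span ℝ {u})ᗮ, ∫⁻ t : ℝ, g (y + t • u) := by
  have h := measurePreserving_line_coordinates hu
  rw [← h.lintegral_comp hg]
  exact lintegral_prod _ (hg.comp h.measurable).aemeasurable

theorem setLIntegral_eq_lintegral_lineSection (hu : ‖u‖ = 1) (hA : IsClosed A)
    {g : EuclideanSpace ℝ (Fin n) → ℝ≥0∞} (hg : Measurable g) :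
    ∫⁻ x in A, g x =
      ∫⁻ y : (Submodule.span ℝ {u})ᗮ, ∫⁻ t in lineSection u A y, g (y + t • u) := by
  rw [← lintegral_indicator hA.measurableSet,
    lintegral_eq_lintegral_lines hu (hg.indicator hA.measurableSet)]
  congr 1 with y
  exact lintegral_indicator (hA.preimage (continuous_line u y)).measurableSet
    fun t : ℝ => g (y + t • u)

theorem measurable_lintegral_lineSection (hA : IsClosed A)
    {g : EuclideanSpace ℝ (Fin n) → ℝ≥0∞} (hg : Measurable g) :
    Measurable fun y : (Submodule.span ℝ {u})ᗮ =>
      ∫⁻ t in lineSection u A y, g (y + t • u) := by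
  have h : Measurable fun p : (Submodule.span ℝ {u})ᗮ × ℝ =>
      A.indicator g ((p.1 : EuclideanSpace ℝ (Fin n)) + p.2 • u) :=
    (hg.indicator hA.measurableSet).comp (by fun_prop)
  convert h.lintegral_prod_right' (ν := volume) using 1
  ext1 y
  exact (lintegral_indicator (hA.preimage (continuous_line u y)).measurableSet
    fun t : ℝ => g (y + t • u)).symm

theorem volume_steinerSymmetral (hu : ‖u‖ = 1) (hA : IsCompact A) :
    volume (steinerSymmetral u A) = volume A := by
  have hS := isClosed_steinerSymmetral hu hA
  rw [← setLIntegral_one, ← setLIntegral_one,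
    setLIntegral_eq_lintegral_lineSection hu hS measurable_const,
    setLIntegral_eq_lintegral_lineSection hu hA.isClosed measurable_const]
  congr 1 with y
  rw [setLIntegral_one, setLIntegral_one, volume_lineSection_steinerSymmetral hu hA
    (Submodule.mem_orthogonal_singleton_iff_inner_right.1 y.2)]

section Sublevel

variable {α : Type*} [MeasurableSpace α] {μ : Measure α} {C I : Set α} {w : α → ℝ≥0∞} {a : ℝ≥0∞}

theorem setLIntegral_sdiff_le_const (hC : MeasurableSet C) (hI : MeasurableSet I)
    (hfin : μ I ≠ ∞) (hvol : μ I = μ C) (hIw : ∀ t ∈ I, w t ≤ a) :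
    ∫⁻ t in I \ C, w t ∂μ ≤ ∫⁻ _ in C \ I, a ∂μ := by
  have hdiff : μ (I \ C) = μ (C \ I) :=
    measure_sdiff_symm hI.nullMeasurableSet hC.nullMeasurableSet hvol
      (measure_ne_top_of_subset inter_subset_left hfin)
  calc ∫⁻ t in I \ C, w t ∂μ ≤ ∫⁻ _ in I \ C, a ∂μ :=
        setLIntegral_mono' (hI.diff hC) fun t ht => hIw t ht.1
    _ = ∫⁻ _ in C \ I, a ∂μ := by simp [hdiff]

/-- Among the sets of a given measure, a sublevel set `I` of `w` minimizes the integral of `w`. -/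
theorem setLIntegral_le_of_sublevel (hC : MeasurableSet C) (hI : MeasurableSet I)
    (hfin : μ I ≠ ∞) (hvol : μ I = μ C) (hIw : ∀ t ∈ I, w t ≤ a) (hCw : ∀ t ∉ I, a < w t) :
    ∫⁻ t in I, w t ∂μ ≤ ∫⁻ t in C, w t ∂μ := by
  rw [← lintegral_inter_add_sdiff w I hC, ← lintegral_inter_add_sdiff w C hI, inter_comm C I]
  gcongr 1
  exact (setLIntegral_sdiff_le_const hC hI hfin hvol hIw).trans
    (setLIntegral_mono' (hC.diff hI) fun t ht => (hCw t ht.2).le)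

/-- A sublevel set `I` of `w` is, up to null sets, the only minimizer of the integral of `w` among
the sets of its measure. -/
theorem measure_sdiff_eq_zero_of_setLIntegral_eq (hC : MeasurableSet C) (hI : MeasurableSet I)
    (hfin : μ I ≠ ∞) (hvol : μ I = μ C) (hw : Measurable w) (ha : a ≠ ∞)
    (hIw : ∀ t ∈ I, w t ≤ a) (hCw : ∀ t ∉ I, a < w t)
    (heq : ∫⁻ t in I, w t ∂μ = ∫⁻ t in C, w t ∂μ) : μ (C \ I) = 0 := by
  by_contra hne
  have hlt : ∫⁻ _ in C \ I, a ∂μ < ∫⁻ t in C \ I, w t ∂μ := by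
    refine setLIntegral_strict_mono (hC.diff hI) hne hw ?_ ?_
    · rw [setLIntegral_const]
      exact ENNReal.mul_ne_top ha (measure_ne_top_of_subset sdiff_subset (hvol ▸ hfin))
    · exact Eventually.of_forall fun t ht => hCw t ht.2
  have hle := setLIntegral_sdiff_le_const hC hI hfin hvol hIw
  have hfin' : ∫⁻ t in I ∩ C, w t ∂μ ≠ ∞ := by
    refine ((setLIntegral_mono' (hI.inter hC) fun t ht => hIw t ht.1).trans_lt ?_).ne
    rw [setLIntegral_const]
    exact ENNReal.mul_lt_top ha.lt_top ((measure_mono inter_subset_left).trans_lt hfin.lt_top)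
  refine heq.not_lt ?_
  rw [← lintegral_inter_add_sdiff w I hC, ← lintegral_inter_add_sdiff w C hI, inter_comm C I]
  exact ENNReal.add_lt_add_left hfin' (hle.trans_lt hlt)

end Sublevel

/-- The second moment `∫ ‖x‖²` over a set. -/
noncomputable def secondMoment (A : Set (EuclideanSpace ℝ (Fin n))) : ℝ≥0∞ :=
  ∫⁻ x in A, ENNReal.ofReal (‖x‖ ^ 2)

theorem measurable_weight : Measurable fun x : EuclideanSpace ℝ (Fin n) =>
    ENNReal.ofReal (‖x‖ ^ 2) := by fun_prop

/-- The centered interval of half-length `b` is a sublevel set of `‖x‖²` on a line. -/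
theorem weight_line (hu : ‖u‖ = 1) {y : EuclideanSpace ℝ (Fin n)} (hy : inner ℝ u y = 0)
    {b : ℝ} (hb : 0 ≤ b) :
    (∀ t ∈ Icc (-b) b, ENNReal.ofReal (‖y + t • u‖ ^ 2) ≤ ENNReal.ofReal (‖y‖ ^ 2 + b ^ 2)) ∧
    (∀ t ∉ Icc (-b) b, ENNReal.ofReal (‖y‖ ^ 2 + b ^ 2) < ENNReal.ofReal (‖y + t • u‖ ^ 2)) := by
  constructor
  · intro t ht
    rw [norm_sq_add_smul hu hy]
    exact ENNReal.ofReal_le_ofReal (by nlinarith [sq_le_sq' ht.1 ht.2])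
  · intro t ht
    rw [mem_Icc, ← abs_le, not_le] at ht
    have : b ^ 2 < t ^ 2 := by rw [← sq_abs t]; exact pow_lt_pow_left₀ ht hb two_ne_zero
    rw [norm_sq_add_smul hu hy,
      ENNReal.ofReal_lt_ofReal_iff (by nlinarith [sq_nonneg b, sq_nonneg ‖y‖])]
    linarith

theorem lintegral_lineSection_steinerSymmetral_le (hu : ‖u‖ = 1) (hA : IsCompact A)
    {y : EuclideanSpace ℝ (Fin n)} (hy : inner ℝ u y = 0) :
    ∫⁻ t in lineSection u (steinerSymmetral u A) y, ENNReal.ofReal (‖y + t • u‖ ^ 2) ≤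
      ∫⁻ t in lineSection u A y, ENNReal.ofReal (‖y + t • u‖ ^ 2) := by
  rcases (lineSection u A y).eq_empty_or_nonempty with h | h
  · simp [lineSection_steinerSymmetral_of_empty hu hy h]
  have hv := volume_lineSection_steinerSymmetral hu hA hy
  have hw := weight_line hu hy (b := (volume (lineSection u A y)).toReal / 2) (by positivity)
  rw [lineSection_steinerSymmetral hu hA hy h] at hv ⊢
  exact setLIntegral_le_of_sublevel (isCompact_lineSection hu hA y).measurableSet measurableSet_Icc
    isCompact_Icc.measure_lt_top.ne hv hw.1 hw.2

theorem volume_lineSection_sdiff_eq_zero (hu : ‖u‖ = 1) (hA : IsCompact A)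
    {y : EuclideanSpace ℝ (Fin n)} (hy : inner ℝ u y = 0)
    (heq : ∫⁻ t in lineSection u (steinerSymmetral u A) y, ENNReal.ofReal (‖y + t • u‖ ^ 2) =
      ∫⁻ t in lineSection u A y, ENNReal.ofReal (‖y + t • u‖ ^ 2)) :
    volume (lineSection u A y \ lineSection u (steinerSymmetral u A) y) = 0 := by
  rcases (lineSection u A y).eq_empty_or_nonempty with h | h
  · simp [h]
  have hv := volume_lineSection_steinerSymmetral hu hA hy
  have hw := weight_line hu hy (b := (volume (lineSection u A y)).toReal / 2) (by positivity)
  rw [lineSection_steinerSymmetral hu hA hy h] at hv heq ⊢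
  exact measure_sdiff_eq_zero_of_setLIntegral_eq (isCompact_lineSection hu hA y).measurableSet
    measurableSet_Icc isCompact_Icc.measure_lt_top.ne hv
    (measurable_weight.comp (continuous_line u y).measurable) ENNReal.ofReal_ne_top hw.1 hw.2 heq

theorem secondMoment_steinerSymmetral_le (hu : ‖u‖ = 1) (hA : IsCompact A) :
    secondMoment (steinerSymmetral u A) ≤ secondMoment A := by
  rw [secondMoment, secondMoment, setLIntegral_eq_lintegral_lineSection hu
    (isClosed_steinerSymmetral hu hA) measurable_weight,
    setLIntegral_eq_lintegral_lineSection hu hA.isClosed measurable_weight]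
  exact lintegral_mono fun y => lintegral_lineSection_steinerSymmetral_le hu hA
    (Submodule.mem_orthogonal_singleton_iff_inner_right.1 y.2)

theorem secondMoment_lt_top (hA : IsCompact A) : secondMoment A < ∞ := by
  refine setLIntegral_lt_top_of_isCompact hA.measure_lt_top.ne hA
    (f := fun x => Real.toNNReal (‖x‖ ^ 2)) (by fun_prop)

/-- A symmetrization that preserves the second moment changes the set by a null set only. -/
theorem volume_sdiff_eq_zero_of_secondMoment_eq (hu : ‖u‖ = 1) (hA : IsCompact A)
    (heq : secondMoment (steinerSymmetral u A) = secondMoment A) :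
    volume (A \ steinerSymmetral u A) = 0 ∧ volume (steinerSymmetral u A \ A) = 0 := by
  have hS := isCompact_steinerSymmetral hu hA
  have h0 : volume (A \ steinerSymmetral u A) = 0 := by
    have hfin := (secondMoment_lt_top hS).ne
    rw [secondMoment, secondMoment, setLIntegral_eq_lintegral_lineSection hu
      hS.isClosed measurable_weight,
      setLIntegral_eq_lintegral_lineSection hu hA.isClosed measurable_weight] at heq
    rw [secondMoment, setLIntegral_eq_lintegral_lineSection hu hS.isClosed measurable_weight]
      at hfin
    have hae := ae_eq_of_ae_le_of_lintegral_le
      (Eventually.of_forall fun y : (Submodule.span ℝ {u})ᗮ =>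
        lintegral_lineSection_steinerSymmetral_le hu hA
          (Submodule.mem_orthogonal_singleton_iff_inner_right.1 y.2)) hfin
      (measurable_lintegral_lineSection hA.isClosed measurable_weight).aemeasurable heq.ge
    have hD : MeasurableSet (A \ steinerSymmetral u A) := hA.measurableSet.diff hS.measurableSet
    rw [← lintegral_indicator_one hD,
      lintegral_eq_lintegral_lines hu (measurable_one.indicator hD)]
    refine lintegral_eq_zero_of_ae_eq_zero ?_
    filter_upwards [hae] with y hy
    have := volume_lineSection_sdiff_eq_zero hu hA
      (Submodule.mem_orthogonal_singleton_iff_inner_right.1 y.2) hy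
    rw [Pi.zero_apply, ← this]
    exact lintegral_indicator_one ((hA.isClosed.preimage (continuous_line u y)).measurableSet.diff
      (hS.isClosed.preimage (continuous_line u y)).measurableSet)
  refine ⟨h0, ?_⟩
  rw [← h0]
  exact measure_sdiff_symm hS.measurableSet.nullMeasurableSet hA.measurableSet.nullMeasurableSet
    (volume_steinerSymmetral hu hA)
    (measure_ne_top_of_subset inter_subset_left hS.measure_lt_top.ne)

end Fubini

/-! ### Iterating finitely many nonexpansive maps in arbitrary order -/

section Iteration

variable {X ι : Type*} [MetricSpace X] {S : ι → X → X} {E : X → ℝ}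
  {v : ℕ → ι} {x : ℕ → X}

/-- A cluster point `G` of the orbit is fixed by every map that is applied infinitely often.
Otherwise, follow the orbit from a time at which it is close to `G` to the first application of a
map that moves `G`: until then it stays close to `G`, and the energy drops there by a definite
amount. -/
theorem fixed_of_mapClusterPt (hS : ∀ i, LipschitzWith 1 (S i))
    (hE : Continuous E) (hle : ∀ i x, E (S i x) ≤ E x) (heq : ∀ i x, E (S i x) = E x → S i x = x)
    (hfin : (range v).Finite) (hx : ∀ m, x (m + 1) = S (v m) (x m)) {G : X}
    (hG : MapClusterPt G atTop x) {i : ι} (hi : ∃ᶠ m in atTop, v m = i) : S i G = G := by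
  by_contra hne
  have hanti : Antitone fun m => E (x m) := antitone_nat_of_succ_le fun m => by
    simp only [hx]; exact hle _ _
  have hlow : ∀ m, E G ≤ E (x m) := by
    intro m
    by_contra! hlt
    obtain ⟨m', hm', h⟩ := ((hG.frequently (hE.continuousAt.eventually
      (lt_mem_nhds hlt))).and_eventually (eventually_ge_atTop m)).exists
    exact (hanti h).not_gt hm'
  -- the maps in use are finitely many, so near `G` all those that move `G` lower the energy below
  -- `E G`
  have hT : {j ∈ range v | S j G ≠ G}.Finite := hfin.subset (sep_subset _ _)
  have hev : ∀ᶠ y in 𝓝 G, ∀ j ∈ {j ∈ range v | S j G ≠ G}, E (S j y) < E G := by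
    rw [hT.eventually_all]
    rintro j ⟨-, hj⟩
    have hlt : E (S j G) < E G := (hle j G).lt_of_ne fun h => hj (heq j G h)
    exact (hE.comp (hS j).continuous).continuousAt.eventually (gt_mem_nhds hlt)
  obtain ⟨ε, hε, hball⟩ := Metric.eventually_nhds_iff.1 hev
  obtain ⟨m, hm⟩ := (hG.frequently (ball_mem_nhds G hε)).exists
  have hex : ∃ k, S (v (m + k)) G ≠ G := by
    obtain ⟨l, hl, hml⟩ := (hi.and_eventually (eventually_ge_atTop m)).exists
    exact ⟨l - m, by rwa [Nat.add_sub_cancel' hml, hl]⟩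
  classical
  have hstay : ∀ k ≤ Nat.find hex, dist (x (m + k)) G < ε := by
    intro k
    induction k with
    | zero => intro _; exact hm
    | succ k ih =>
      intro hk
      have hfix : S (v (m + k)) G = G := not_not.1 (Nat.find_min hex hk)
      rw [← add_assoc, hx, ← hfix]
      refine ((hS _).dist_le_mul _ _).trans_lt ?_
      simpa using ih (Nat.le_of_succ_le hk)
  have h1 := hball (hstay _ le_rfl) _ ⟨mem_range_self _, Nat.find_spec hex⟩
  rw [← hx] at h1
  exact (hlow _).not_gt h1

/-- Finitely many nonexpansive maps of a compact metric space that strictly decrease a common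
continuous energy off their fixed points, applied in any order, generate convergent orbits. -/
theorem exists_tendsto_of_energy [CompactSpace X] (hS : ∀ i, LipschitzWith 1 (S i))
    (hE : Continuous E) (hle : ∀ i x, E (S i x) ≤ E x) (heq : ∀ i x, E (S i x) = E x → S i x = x)
    (hfin : (range v).Finite) (hx : ∀ m, x (m + 1) = S (v m) (x m)) :
    ∃ G, Tendsto x atTop (𝓝 G) ∧ ∀ i, (∃ᶠ m in atTop, v m = i) → S i G = G := by
  obtain ⟨G, -, hG⟩ := isCompact_univ.exists_mapClusterPt (f := atTop) (u := x) (by simp)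
  have hfix := fun i (hi : ∃ᶠ m in atTop, v m = i) =>
    fixed_of_mapClusterPt hS hE hle heq hfin hx hG hi
  refine ⟨G, ?_, hfix⟩
  -- from some time on, only maps that fix `G` are applied, and the distance to `G` decreases
  have hev : ∀ᶠ m in atTop, S (v m) G = G := by
    have : ∀ᶠ m in atTop, ∀ j ∈ {j ∈ range v | S j G ≠ G}, v m ≠ j := by
      rw [(hfin.subset (sep_subset _ _)).eventually_all]
      rintro j ⟨-, hj⟩
      exact not_frequently.1 fun h => hj (hfix j h)
    filter_upwards [this] with m hm
    by_contra h
    exact hm _ ⟨mem_range_self _, h⟩ rfl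
  obtain ⟨M, hM⟩ := eventually_atTop.1 hev
  rw [Metric.tendsto_atTop]
  intro ε hε
  obtain ⟨m, hm, hMm⟩ := ((hG.frequently (ball_mem_nhds G hε)).and_eventually
    (eventually_ge_atTop M)).exists
  refine ⟨m, fun k hk => ?_⟩
  induction k, hk using Nat.le_induction with
  | base => exact hm
  | succ k hk ih =>
    rw [hx, ← hM k (hMm.trans hk)]
    refine ((hS _).dist_le_mul _ _).trans_lt ?_
    simpa using ih

end Iteration

/-! ### Symmetrization of functions -/

section Profiles

variable {n : ℕ} {u : EuclideanSpace ℝ (Fin n)} {ρ : ℝ} {f g : EuclideanSpace ℝ (Fin n) → ℝ}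

/-- The `1`-Lipschitz functions with values in `[0, 1]` that vanish off the ball of radius `ρ`. -/
structure IsProfile (ρ : ℝ) (f : EuclideanSpace ℝ (Fin n) → ℝ) : Prop where
  lipschitz : LipschitzWith 1 f
  nonneg : ∀ x, 0 ≤ f x
  le_one : ∀ x, f x ≤ 1
  eq_zero : ∀ x, ρ < ‖x‖ → f x = 0

/-- The closed superlevel sets of a function. -/
def superlevel (f : EuclideanSpace ℝ (Fin n) → ℝ) (t : ℝ) : Set (EuclideanSpace ℝ (Fin n)) :=
  {x | t ≤ f x}

/-- The Steiner symmetral of a function, whose superlevel sets are the symmetrals of the superlevel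
sets of `f` (see `le_steinerFun_iff`). Only positive levels are used, and the value is the junk
value `sSup ∅ = 0` where none of them is attained. -/
noncomputable def steinerFun (u : EuclideanSpace ℝ (Fin n)) (f : EuclideanSpace ℝ (Fin n) → ℝ)
    (x : EuclideanSpace ℝ (Fin n)) : ℝ :=
  sSup {t | 0 < t ∧ x ∈ steinerSymmetral u (superlevel f t)}

theorem superlevel_anti (f : EuclideanSpace ℝ (Fin n) → ℝ) : Antitone (superlevel f) :=
  fun _ _ hst _ hx => hst.trans hx

namespace IsProfile

theorem superlevel_subset (hf : IsProfile ρ f) {t : ℝ} (ht : 0 < t) :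
    superlevel f t ⊆ closedBall 0 ρ := fun x hx => by
  rw [mem_closedBall_zero_iff]
  by_contra! h
  exact (ht.trans_le hx).ne' (hf.eq_zero x h)

theorem isCompact_superlevel (hf : IsProfile ρ f) {t : ℝ} (ht : 0 < t) :
    IsCompact (superlevel f t) :=
  (isCompact_closedBall 0 ρ).of_isClosed_subset
    (isClosed_le continuous_const hf.lipschitz.continuous) (hf.superlevel_subset ht)

theorem cthickening_superlevel_subset (hf : IsProfile ρ f) {t δ : ℝ} (ht : 0 < t) (hδ : 0 ≤ δ) :
    cthickening δ (superlevel f t) ⊆ superlevel f (t - δ) := by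
  rw [(hf.isCompact_superlevel ht).cthickening_eq_biUnion_closedBall hδ]
  intro x hx
  simp only [mem_iUnion, mem_closedBall] at hx
  obtain ⟨y, hy, hd⟩ := hx
  have h1 := (hf.lipschitz.dist_le_mul x y).trans (by simpa using hd)
  have h2 : t ≤ f y := hy
  rw [Real.dist_eq, abs_le] at h1
  change t - δ ≤ f x
  linarith

/-- The superlevel sets of a profile depend on the level continuously from the left. -/
theorem exists_superlevel_subset_thickening (hf : IsProfile ρ f) {t ε : ℝ} (ht : 0 < t)
    (hε : 0 < ε) : ∃ s, 0 < s ∧ s < t ∧ superlevel f s ⊆ thickening ε (superlevel f t) := by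
  have hC : IsCompact (superlevel f (t / 2) \ thickening ε (superlevel f t)) :=
    (hf.isCompact_superlevel (half_pos ht)).diff isOpen_thickening
  rcases eq_empty_or_nonempty (superlevel f (t / 2) \ thickening ε (superlevel f t)) with h | h
  · exact ⟨t / 2, half_pos ht, half_lt_self ht, sdiff_eq_empty.1 h⟩
  · obtain ⟨z, hz, hmax⟩ := hC.exists_isMaxOn h hf.lipschitz.continuous.continuousOn
    have hzt : f z < t := not_le.1 fun h => hz.2 (self_subset_thickening hε _ h)
    have hz2 : t / 2 ≤ f z := hz.1
    refine ⟨(f z + t) / 2, by linarith, by linarith, fun x hx => ?_⟩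
    by_contra hcon
    have h1 : (f z + t) / 2 ≤ f x := hx
    have h2 : f x ≤ f z := hmax ⟨show t / 2 ≤ f x by linarith, hcon⟩
    linarith

theorem one_mem_upperBounds_levels (hf : IsProfile ρ f) (u x : EuclideanSpace ℝ (Fin n)) :
    1 ∈ upperBounds {t | 0 < t ∧ x ∈ steinerSymmetral u (superlevel f t)} := by
  rintro t ⟨-, hx⟩
  by_contra! h
  have : superlevel f t = ∅ :=
    eq_empty_of_forall_notMem fun z hz => (h.trans_le hz).not_ge (hf.le_one z)
  rw [this, steinerSymmetral_empty] at hx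
  exact hx

theorem le_steinerFun_iff (hf : IsProfile ρ f) (hu : ‖u‖ = 1) {t : ℝ} (ht : 0 < t)
    {x : EuclideanSpace ℝ (Fin n)} :
    t ≤ steinerFun u f x ↔ x ∈ steinerSymmetral u (superlevel f t) := by
  refine ⟨fun h => ?_, fun h => le_csSup ⟨1, hf.one_mem_upperBounds_levels u x⟩ ⟨ht, h⟩⟩
  by_contra hx
  obtain ⟨ε, hε, H⟩ := exists_notMem_steinerSymmetral_cthickening hu (hf.isCompact_superlevel ht) hx
  obtain ⟨s, hs0, hst, hs⟩ := hf.exists_superlevel_subset_thickening ht hε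
  have hne : {t | 0 < t ∧ x ∈ steinerSymmetral u (superlevel f t)}.Nonempty := by
    by_contra! hem
    rw [steinerFun, hem, Real.sSup_empty] at h
    exact ht.not_ge h
  obtain ⟨t', ⟨-, hx'⟩, hst'⟩ := exists_lt_of_lt_csSup hne (hst.trans_le h)
  refine H x (by simpa using hε) (steinerSymmetral_mono ?_ hx')
  exact (superlevel_anti f hst'.le).trans (hs.trans (thickening_subset_cthickening _ _))

theorem superlevel_steinerFun (hf : IsProfile ρ f) (hu : ‖u‖ = 1) {t : ℝ} (ht : 0 < t) :
    superlevel (steinerFun u f) t = steinerSymmetral u (superlevel f t) :=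
  Set.ext fun _ => hf.le_steinerFun_iff hu ht

theorem steinerFun_nonneg (u : EuclideanSpace ℝ (Fin n)) (f : EuclideanSpace ℝ (Fin n) → ℝ)
    (x : EuclideanSpace ℝ (Fin n)) : 0 ≤ steinerFun u f x :=
  Real.sSup_nonneg fun _ ht => ht.1.le

/-- Symmetrization is nonexpansive for the supremum distance. -/
theorem steinerFun_le_add (hf : IsProfile ρ f) (hg : IsProfile ρ g) (hu : ‖u‖ = 1) {ε : ℝ}
    (hε : 0 ≤ ε) (h : ∀ x, f x ≤ g x + ε) (x : EuclideanSpace ℝ (Fin n)) :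
    steinerFun u f x ≤ steinerFun u g x + ε := by
  by_contra! hlt
  have h0 := steinerFun_nonneg u g x
  have ht : 0 < steinerFun u f x := by linarith
  have hx := (hf.le_steinerFun_iff hu ht).1 le_rfl
  have hx' : x ∈ steinerSymmetral u (superlevel g (steinerFun u f x - ε)) :=
    steinerSymmetral_mono (fun z hz => sub_le_iff_le_add.2 (le_trans hz (h z))) hx
  have := (hg.le_steinerFun_iff hu (by linarith)).2 hx'
  linarith

theorem isProfile_steinerFun (hf : IsProfile ρ f) (hu : ‖u‖ = 1) : IsProfile ρ (steinerFun u f) where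
  nonneg := steinerFun_nonneg u f
  le_one x := Real.sSup_le (hf.one_mem_upperBounds_levels u x) zero_le_one
  eq_zero x hx := by
    refine le_antisymm (not_lt.1 fun h => ?_) (steinerFun_nonneg u f x)
    have := steinerSymmetral_subset_closedBall hu (hf.superlevel_subset h)
      ((hf.le_steinerFun_iff hu h).1 le_rfl)
    exact hx.not_ge (mem_closedBall_zero_iff.1 this)
  lipschitz := by
    refine LipschitzWith.of_le_add fun x y => ?_
    by_contra! hlt
    have h0 := steinerFun_nonneg u f y
    have hd : 0 ≤ dist x y := dist_nonneg
    have ht : 0 < steinerFun u f x := by linarith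
    have hx := (hf.le_steinerFun_iff hu ht).1 le_rfl
    have hy : y ∈ steinerSymmetral u (superlevel f (steinerFun u f x - dist x y)) := by
      refine steinerSymmetral_mono (hf.cthickening_superlevel_subset ht hd) ?_
      refine cthickening_steinerSymmetral_subset hu (hf.isCompact_superlevel ht) hd ?_
      exact mem_cthickening_of_dist_le _ _ _ _ hx (dist_comm x y).ge
    have := (hf.le_steinerFun_iff hu (by linarith)).2 hy
    linarith

end IsProfile

/-- The measure on the ball of radius `ρ` with density `‖x‖²`. -/
noncomputable def momentMeasure (n : ℕ) (ρ : ℝ) : Measure (EuclideanSpace ℝ (Fin n)) :=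
  (volume.restrict (closedBall 0 ρ)).withDensity fun x => ENNReal.ofReal (‖x‖ ^ 2)

theorem momentMeasure_apply {A : Set (EuclideanSpace ℝ (Fin n))} (hA : MeasurableSet A)
    (hAρ : A ⊆ closedBall 0 ρ) : momentMeasure n ρ A = secondMoment A := by
  rw [momentMeasure, withDensity_apply _ hA, Measure.restrict_restrict hA,
    inter_eq_left.2 hAρ, secondMoment]

instance : IsFiniteMeasure (momentMeasure n ρ) := by
  refine isFiniteMeasure_withDensity ?_
  exact (secondMoment_lt_top (isCompact_closedBall (0 : EuclideanSpace ℝ (Fin n)) ρ)).ne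

namespace IsProfile

/-- The energy `∫ f(x) ‖x‖² dx` by the layer-cake formula. -/
theorem lintegral_momentMeasure (hf : IsProfile ρ f) :
    ∫⁻ x, ENNReal.ofReal (f x) ∂momentMeasure n ρ =
      ∫⁻ t in Ioi (0 : ℝ), secondMoment (superlevel f t) := by
  rw [lintegral_eq_lintegral_meas_le _ (Eventually.of_forall hf.nonneg)
    hf.lipschitz.continuous.measurable.aemeasurable]
  refine setLIntegral_congr_fun measurableSet_Ioi fun t ht => ?_
  exact momentMeasure_apply (hf.isCompact_superlevel ht).measurableSet (hf.superlevel_subset ht)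

theorem lintegral_ne_top (hf : IsProfile ρ f) :
    ∫⁻ x, ENNReal.ofReal (f x) ∂momentMeasure n ρ ≠ ∞ := by
  refine ((lintegral_mono (g := fun _ => 1) fun x => ?_).trans_lt ?_).ne
  · exact ENNReal.ofReal_le_one.2 (hf.le_one x)
  · simp

theorem integral_eq_toReal (hf : IsProfile ρ f) :
    ∫ x, f x ∂momentMeasure n ρ = (∫⁻ x, ENNReal.ofReal (f x) ∂momentMeasure n ρ).toReal :=
  integral_eq_lintegral_of_nonneg_ae (Eventually.of_forall hf.nonneg)
    hf.lipschitz.continuous.aestronglyMeasurable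

theorem lintegral_steinerFun_le (hf : IsProfile ρ f) (hu : ‖u‖ = 1) :
    ∫⁻ x, ENNReal.ofReal (steinerFun u f x) ∂momentMeasure n ρ ≤
      ∫⁻ x, ENNReal.ofReal (f x) ∂momentMeasure n ρ := by
  rw [hf.lintegral_momentMeasure, (hf.isProfile_steinerFun hu).lintegral_momentMeasure]
  refine setLIntegral_mono' measurableSet_Ioi fun t ht => ?_
  rw [hf.superlevel_steinerFun hu ht]
  exact secondMoment_steinerSymmetral_le hu (hf.isCompact_superlevel ht)

/-- A profile whose energy is preserved by symmetrization is its own symmetral: almost all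
superlevel sets change by null sets only, and a strict inequality between the two continuous functions at a
point would separate their superlevel sets on an open set, for an interval of levels. -/
theorem steinerFun_eq_of_lintegral_eq (hf : IsProfile ρ f) (hu : ‖u‖ = 1)
    (heq : ∫⁻ x, ENNReal.ofReal (steinerFun u f x) ∂momentMeasure n ρ =
      ∫⁻ x, ENNReal.ofReal (f x) ∂momentMeasure n ρ) : steinerFun u f = f := by
  have hS := hf.isProfile_steinerFun hu
  have hfin := hS.lintegral_ne_top
  rw [hf.lintegral_momentMeasure, hS.lintegral_momentMeasure] at heq
  rw [hS.lintegral_momentMeasure] at hfin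
  have hmeas : Measurable fun t => secondMoment (superlevel f t) :=
    Antitone.measurable fun s t hst => lintegral_mono_set (superlevel_anti f hst)
  have hae := ae_eq_of_ae_le_of_lintegral_le ((ae_restrict_iff' measurableSet_Ioi).2
    (Eventually.of_forall fun t ht => by
      rw [hf.superlevel_steinerFun hu ht]
      exact secondMoment_steinerSymmetral_le hu (hf.isCompact_superlevel ht))) hfin
    hmeas.aemeasurable heq.ge
  have hdense := Measure.dense_of_ae ((ae_restrict_iff' measurableSet_Ioi).1 hae)
  have hnull : ∀ s s' : ℝ, 0 ≤ s → s < s' → ∃ t ∈ Ioo s s',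
      volume (superlevel f t \ superlevel (steinerFun u f) t) = 0 ∧
      volume (superlevel (steinerFun u f) t \ superlevel f t) = 0 := by
    intro s s' hs hss
    obtain ⟨t, ht, htI⟩ := hdense.exists_between hss
    have ht0 : 0 < t := hs.trans_lt htI.1
    have h2 : secondMoment (superlevel (steinerFun u f) t) = secondMoment (superlevel f t) := ht ht0
    rw [hf.superlevel_steinerFun hu ht0] at h2
    refine ⟨t, htI, ?_⟩
    rw [hf.superlevel_steinerFun hu ht0]
    exact volume_sdiff_eq_zero_of_secondMoment_eq hu (hf.isCompact_superlevel ht0) h2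
  have key : ∀ g h : EuclideanSpace ℝ (Fin n) → ℝ, IsProfile ρ g → IsProfile ρ h →
      (∀ s s' : ℝ, 0 ≤ s → s < s' → ∃ t ∈ Ioo s s',
        volume (superlevel h t \ superlevel g t) = 0) → ∀ x, h x ≤ g x := by
    intro g h hg hh H x
    by_contra! hlt
    obtain ⟨s, hs1, hs2⟩ := exists_between hlt
    obtain ⟨t, ht, h0⟩ := H s (h x) ((hg.nonneg x).trans hs1.le) hs2
    have hU : IsOpen {z | g z < t ∧ t < h z} :=
      (isOpen_lt hg.lipschitz.continuous continuous_const).inter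
        (isOpen_lt continuous_const hh.lipschitz.continuous)
    refine (hU.measure_pos volume ⟨x, hs1.trans ht.1, ht.2⟩).ne'
      (measure_mono_null (t := superlevel h t \ superlevel g t)
        (fun z hz => ⟨hz.2.le, not_le.2 hz.1⟩) h0)
  funext x
  refine le_antisymm (key _ _ hf hS (fun s s' hs h => ?_) x) (key _ _ hS hf (fun s s' hs h => ?_) x)
  · obtain ⟨t, ht, -, h2⟩ := hnull s s' hs h
    exact ⟨t, ht, h2⟩
  · obtain ⟨t, ht, h1, -⟩ := hnull s s' hs h
    exact ⟨t, ht, h1⟩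

end IsProfile

/-- The profiles as a subset of the space of bounded continuous functions with the supremum
distance. -/
def profiles (n : ℕ) (ρ : ℝ) : Set (EuclideanSpace ℝ (Fin n) →ᵇ ℝ) := {f | IsProfile ρ f}

theorem isClosed_profiles : IsClosed (profiles n ρ) := by
  have : profiles n ρ = {f | (∀ x y, dist (f x) (f y) ≤ dist x y) ∧ (∀ x, 0 ≤ f x) ∧
      (∀ x, f x ≤ 1) ∧ ∀ x, ρ < ‖x‖ → f x = 0} := by
    ext f
    exact ⟨fun h => ⟨fun x y => by simpa using h.lipschitz.dist_le_mul x y, h.nonneg, h.le_one,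
      h.eq_zero⟩, fun h => ⟨LipschitzWith.of_dist_le_mul fun x y => by simpa using h.1 x y,
      h.2.1, h.2.2.1, h.2.2.2⟩⟩
  rw [this]
  have hc : ∀ x, Continuous fun f : EuclideanSpace ℝ (Fin n) →ᵇ ℝ => f x := fun x =>
    continuous_eval_const x
  simp only [ofPred_and, ofPred_forall]
  refine IsClosed.inter ?_ (IsClosed.inter ?_ (IsClosed.inter ?_ ?_))
  · exact isClosed_iInter fun x => isClosed_iInter fun y =>
      isClosed_le ((hc x).dist (hc y)) continuous_const
  · exact isClosed_iInter fun x => isClosed_le continuous_const (hc x)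
  · exact isClosed_iInter fun x => isClosed_le (hc x) continuous_const
  · exact isClosed_iInter fun x => isClosed_iInter fun _ => isClosed_eq (hc x) continuous_const

/-- Arzelà–Ascoli: it applies to the restrictions to the ball of radius `ρ`, and restricting is
isometric on profiles, as they all vanish off that ball. -/
instance : CompactSpace (profiles n ρ) := by
  let r : profiles n ρ → (closedBall (0 : EuclideanSpace ℝ (Fin n)) ρ →ᵇ ℝ) :=
    fun f => f.1.domRestrict _
  have : CompactSpace (closedBall (0 : EuclideanSpace ℝ (Fin n)) ρ) :=
    isCompact_iff_compactSpace.1 (isCompact_closedBall 0 ρ)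
  have hr : Isometry r := by
    refine Isometry.of_dist_eq fun f g => le_antisymm ?_ ?_
    · exact (BoundedContinuousFunction.dist_le dist_nonneg).2 fun x => f.1.dist_coe_le_dist x.1
    · refine (BoundedContinuousFunction.dist_le dist_nonneg).2 fun x => ?_
      by_cases hx : x ∈ closedBall (0 : EuclideanSpace ℝ (Fin n)) ρ
      · exact (r f).dist_coe_le_dist (g := r g) ⟨x, hx⟩
      · rw [mem_closedBall_zero_iff, not_le] at hx
        rw [f.2.eq_zero x hx, g.2.eq_zero x hx, dist_self]
        exact dist_nonneg
  have hcpt : IsCompact (closure (range r)) := by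
    refine BoundedContinuousFunction.arzela_ascoli (Icc 0 1) isCompact_Icc _ ?_ ?_
    · rintro _ x ⟨f, rfl⟩
      exact ⟨f.2.nonneg _, f.2.le_one _⟩
    · refine LipschitzWith.uniformEquicontinuous _ 1 ?_ |>.equicontinuous
      rintro ⟨_, f, rfl⟩
      exact mul_one (1 : NNReal) ▸ f.2.lipschitz.comp (LipschitzWith.subtype_val _)
  have := isClosed_profiles (n := n) (ρ := ρ).completeSpace_coe
  refine ⟨isCompact_iff_totallyBounded_isComplete.2 ⟨?_, completeSpace_iff_isComplete_univ.1 this⟩⟩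
  refine (totallyBounded_preimage hr.isUniformInducing (hcpt.totallyBounded)).subset ?_
  exact fun f _ => subset_closure (mem_range_self f)

/-- A profile as a point of the space of profiles. -/
noncomputable def IsProfile.toProfiles (hf : IsProfile ρ f) : profiles n ρ :=
  ⟨BoundedContinuousFunction.ofNormedAddCommGroup f hf.lipschitz.continuous 1 fun x => by
    rw [Real.norm_eq_abs, abs_of_nonneg (hf.nonneg x)]; exact hf.le_one x, hf⟩

/-- Steiner symmetrization as a map of the space of profiles. -/
noncomputable def symmetrize (ρ : ℝ) (u : sphere (0 : EuclideanSpace ℝ (Fin n)) 1)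
    (f : profiles n ρ) : profiles n ρ :=
  (f.2.isProfile_steinerFun (norm_eq_of_mem_sphere u)).toProfiles

theorem coe_symmetrize (u : sphere (0 : EuclideanSpace ℝ (Fin n)) 1) (f : profiles n ρ) :
    ((symmetrize ρ u f).1 : EuclideanSpace ℝ (Fin n) → ℝ) = steinerFun u f.1 := rfl

theorem lipschitzWith_symmetrize (u : sphere (0 : EuclideanSpace ℝ (Fin n)) 1) :
    LipschitzWith 1 (symmetrize ρ u) := by
  have key : ∀ f g : profiles n ρ, ∀ x,
      (symmetrize ρ u f).1 x ≤ (symmetrize ρ u g).1 x + dist f g := fun f g x => by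
    refine f.2.steinerFun_le_add g.2 (norm_eq_of_mem_sphere u) dist_nonneg (fun z => ?_) x
    have h := (abs_le.1 (Real.dist_eq _ _ ▸ f.1.dist_coe_le_dist (g := g.1) z)).2
    have h' : dist f g = dist f.1 g.1 := rfl
    linarith
  refine LipschitzWith.of_dist_le_mul fun f g => ?_
  rw [NNReal.coe_one, one_mul]
  refine (BoundedContinuousFunction.dist_le dist_nonneg).2 fun x => ?_
  rw [Real.dist_eq, abs_le]
  have h1 := key f g x
  have h2 := key g f x
  rw [dist_comm] at h2
  constructor <;> linarith

/-- Successive symmetrizations of a profile along finitely many directions converge uniformly. -/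
theorem exists_tendsto_symmetrize {F : Set (EuclideanSpace ℝ (Fin n))} (hFfin : F.Finite)
    {v : ℕ → sphere (0 : EuclideanSpace ℝ (Fin n)) 1}
    (hv : ∀ m, (v m : EuclideanSpace ℝ (Fin n)) ∈ F)
    {x : ℕ → profiles n ρ} (hx : ∀ m, x (m + 1) = symmetrize ρ (v m) (x m)) :
    ∃ G, Tendsto x atTop (𝓝 G) ∧ ∀ w, (∃ᶠ m in atTop, v m = w) → symmetrize ρ w G = G := by
  refine exists_tendsto_of_energy (E := fun f => ∫ x, f.1 x ∂momentMeasure n ρ)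
    lipschitzWith_symmetrize ?_ ?_ ?_ ?_ hx
  · refine continuous_of_dominated (bound := fun _ => 1) ?_ ?_ ?_ ?_
    · exact fun f => f.1.continuous.aestronglyMeasurable
    · refine fun f => Eventually.of_forall fun z => ?_
      rw [Real.norm_eq_abs, abs_of_nonneg (f.2.nonneg z)]
      exact f.2.le_one z
    · exact integrable_const _
    · exact Eventually.of_forall fun z =>
        (continuous_eval_const z).comp continuous_subtype_val
  · intro w f
    rw [f.2.integral_eq_toReal, (symmetrize ρ w f).2.integral_eq_toReal]
    exact ENNReal.toReal_mono f.2.lintegral_ne_top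
      (f.2.lintegral_steinerFun_le (norm_eq_of_mem_sphere w))
  · intro w f h
    rw [f.2.integral_eq_toReal, (symmetrize ρ w f).2.integral_eq_toReal,
      ENNReal.toReal_eq_toReal_iff' (symmetrize ρ w f).2.lintegral_ne_top f.2.lintegral_ne_top] at h
    exact Subtype.ext (DFunLike.coe_injective
      (f.2.steinerFun_eq_of_lintegral_eq (norm_eq_of_mem_sphere w) h))
  · exact (hFfin.preimage Subtype.val_injective.injOn).subset (range_subset_iff.2 hv)

end Profiles

/-! ### Convergence of sets from upper bounds and parallel volumes -/

section Convergence

variable {n : ℕ} {L : Set (EuclideanSpace ℝ (Fin n))} {C : ℕ → Set (EuclideanSpace ℝ (Fin n))}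

theorem exists_volume_cthickening_lt (hL : IsCompact L) {b : ℝ≥0∞} (hb : b ≠ 0) {r : ℝ}
    (hr : 0 < r) : ∃ ε, 0 < ε ∧ ε ≤ r ∧ volume (cthickening ε L) < volume L + b := by
  have hlim := (tendsto_measure_cthickening_of_isCompact (μ := volume) hL).mono_left
    (nhdsWithin_le_nhds (s := Ioi 0))
  have hlt : volume L < volume L + b := ENNReal.lt_add_right hL.measure_lt_top.ne hb
  have hr' : ∀ᶠ ε in 𝓝[>] (0 : ℝ), ε ∈ Ioc 0 r := Ioc_mem_nhdsGT hr
  obtain ⟨ε, h3, h1, h2⟩ := ((hlim.eventually (gt_mem_nhds hlt)).and hr').exists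
  exact ⟨ε, h1, h2, h3⟩

/-- If the sets `C m` eventually lie near `L` and no parallel set of `L` has larger volume than the
slightly larger parallel sets of `C m`, then `L` lies near `C m`: otherwise a parallel set of
`C m` would miss a ball of fixed radius contained in a parallel set of `L`. -/
theorem eventually_subset_cthickening (hL : IsCompact L)
    (hsub : ∀ ε > 0, ∀ᶠ m in atTop, C m ⊆ cthickening ε L)
    (hvol : ∀ m, ∀ δ ≥ 0, ∀ ε > 0, volume (cthickening δ L) ≤ volume (cthickening (δ + ε) (C m)))
    {r : ℝ} (hr : 0 < r) : ∀ᶠ m in atTop, L ⊆ cthickening r (C m) := by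
  obtain ⟨δ, hδ, rfl⟩ : ∃ δ > 0, r = 3 * δ := ⟨r / 3, by positivity, by ring⟩
  have hb : volume (ball (0 : EuclideanSpace ℝ (Fin n)) δ) ≠ 0 := (measure_ball_pos _ _ hδ).ne'
  obtain ⟨ε, hε, hεδ, hlt⟩ := exists_volume_cthickening_lt (hL.cthickening (r := δ)) hb hδ
  filter_upwards [hsub (ε / 2) (half_pos hε)] with m hm x hx
  by_contra hcon
  have hdisj : Disjoint (cthickening (δ + ε / 2) (C m)) (ball x δ) := by
    rw [Set.disjoint_left]
    intro z hz hzx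
    refine hcon (cthickening_mono (by linarith) _ (cthickening_cthickening_subset hδ.le
      (by positivity : 0 ≤ δ + ε / 2) _ (mem_cthickening_of_dist_le x z _ _ hz ?_)))
    exact (mem_ball'.1 hzx).le
  have hsub1 : cthickening (δ + ε / 2) (C m) ⊆ cthickening ε (cthickening δ L) := by
    rw [cthickening_cthickening hε.le hδ.le]
    refine (cthickening_subset_of_subset _ hm).trans
      ((cthickening_cthickening_subset (by positivity) (by positivity) _).trans
        (cthickening_mono (by linarith) _))
  have hsub2 : ball x δ ⊆ cthickening ε (cthickening δ L) := fun z hz =>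
    self_subset_cthickening _ (mem_cthickening_of_dist_le z x _ _ hx (mem_ball.1 hz).le)
  refine hlt.not_ge ?_
  rw [← Measure.addHaar_ball_center volume x δ]
  refine (add_le_add_left (hvol m δ hδ.le (ε / 2) (half_pos hε)) _).trans ?_
  rw [← measure_union hdisj measurableSet_ball]
  exact measure_mono (union_subset hsub1 hsub2)

theorem tendsto_hausdorffEDist (hL : IsCompact L)
    (hsub : ∀ ε > 0, ∀ᶠ m in atTop, C m ⊆ cthickening ε L)
    (hvol : ∀ m, ∀ δ ≥ 0, ∀ ε > 0, volume (cthickening δ L) ≤ volume (cthickening (δ + ε) (C m))) :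
    Tendsto (fun m => hausdorffEDist (C m) L) atTop (𝓝 0) := by
  rw [ENNReal.tendsto_nhds_zero]
  intro b hb
  obtain ⟨r, hr, hrb⟩ := ENNReal.lt_iff_exists_nnreal_btwn.1 hb
  have hr0 : 0 < (r : ℝ) := NNReal.coe_pos.2 (ENNReal.coe_pos.1 hr)
  filter_upwards [hsub r hr0, eventually_subset_cthickening hL hsub hvol hr0] with m h1 h2
  rw [← ENNReal.ofReal_coe_nnreal] at hrb
  exact (hausdorffEDist_le_of_infEDist (fun z hz => h1 hz) (fun z hz => h2 hz)).trans hrb.le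

theorem volume_le_of_cthickening (hL : IsCompact L) {A : Set (EuclideanSpace ℝ (Fin n))}
    (hA : IsCompact A)
    (hvol : ∀ δ ≥ 0, ∀ ε > 0, volume (cthickening δ L) ≤ volume (cthickening (δ + ε) A)) :
    volume L ≤ volume A := by
  have hlim := (tendsto_measure_cthickening_of_isCompact (μ := volume) hA).mono_left
    (nhdsWithin_le_nhds (s := Ioi 0))
  refine ge_of_tendsto hlim (eventually_mem_nhdsWithin.mono fun ε hε => ?_)
  have := hvol 0 le_rfl ε hε
  rwa [zero_add, cthickening_zero, hL.isClosed.closure_eq] at this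

/-- Both parts of the symmetric difference lie in a small parallel set of `L`, off a set of volume
at least that of `L`. -/
theorem tendsto_volume_symmDiff (hL : IsCompact L) (hC : ∀ m, IsCompact (C m))
    (hsub : ∀ ε > 0, ∀ᶠ m in atTop, C m ⊆ cthickening ε L)
    (hvol : ∀ m, volume L ≤ volume (C m)) :
    Tendsto (fun m => volume (symmDiff (C m) L)) atTop (𝓝 0) := by
  rw [ENNReal.tendsto_nhds_zero]
  intro b hb
  obtain ⟨ε, hε, -, hlt⟩ := exists_volume_cthickening_lt hL (ENNReal.half_pos hb.ne').ne' one_pos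
  filter_upwards [hsub ε hε] with m hm
  have hle : ∀ A B : Set (EuclideanSpace ℝ (Fin n)), IsCompact A → A ⊆ cthickening ε L →
      B ⊆ cthickening ε L → MeasurableSet B → volume L ≤ volume A → volume (B \ A) ≤ b / 2 := by
    intro A B hA hAs hBs hB hv
    have h1 : volume A + volume (B \ A) ≤ volume (cthickening ε L) := by
      rw [← measure_union disjoint_sdiff_right (hB.diff hA.measurableSet), union_sdiff_self]
      exact measure_mono (union_subset hAs hBs)
    have h2 : volume A + volume (B \ A) ≤ volume A + b / 2 :=
      h1.trans (hlt.le.trans (by gcongr))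
    exact (ENNReal.add_le_add_iff_left hA.measure_lt_top.ne).1 h2
  have hLs := self_subset_cthickening (δ := ε) L
  rw [symmDiff_def]
  refine (measure_union_le _ _).trans ?_
  rw [← ENNReal.add_halves b]
  exact add_le_add (hle L (C m) hL hLs hm (hC m).measurableSet le_rfl)
    (hle (C m) L (hC m) hm hLs hL.measurableSet (hvol m))

end Convergence

/-! ### Iterated symmetrals -/

section Iterated

variable {n : ℕ} {u : ℕ → EuclideanSpace ℝ (Fin n)} {K : Set (EuclideanSpace ℝ (Fin n))}

theorem isCompact_iteratedSymmetral (hu : ∀ m, ‖u m‖ = 1) (hK : IsCompact K) (m : ℕ) :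
    IsCompact (iteratedSymmetral u K m) := by
  induction m with
  | zero => exact hK
  | succ m ih => exact isCompact_steinerSymmetral (hu m) ih

theorem iteratedSymmetral_empty (m : ℕ) : iteratedSymmetral u ∅ m = ∅ := by
  induction m with
  | zero => rfl
  | succ m ih => rw [iteratedSymmetral, ih, steinerSymmetral_empty]

/-- The volumes of the parallel sets decrease under symmetrization. -/
theorem antitone_volume_cthickening_iteratedSymmetral (hu : ∀ m, ‖u m‖ = 1) (hK : IsCompact K)
    {δ : ℝ} (hδ : 0 ≤ δ) :
    Antitone fun m => volume (cthickening δ (iteratedSymmetral u K m)) := by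
  refine antitone_nat_of_succ_le fun m => ?_
  have hc := isCompact_iteratedSymmetral hu hK m
  rw [← volume_steinerSymmetral (hu m) hc.cthickening]
  exact measure_mono (cthickening_steinerSymmetral_subset (hu m) hc hδ)

/-- The tent function of a nonempty compact set is a profile with superlevel set `K` at level
`1`. -/
theorem exists_profile (hK : IsCompact K) (hne : K.Nonempty) :
    ∃ ρ, ∃ f : profiles n ρ, superlevel f.1 1 = K := by
  obtain ⟨R, hR⟩ := hK.isBounded.subset_closedBall 0
  have hf : IsProfile (R + 1) fun x => max 0 (1 - infDist x K) := by
    refine ⟨?_, fun x => le_max_left _ _, fun x => max_le zero_le_one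
      (sub_le_self _ infDist_nonneg), fun x hx => max_eq_left ?_⟩
    · refine LipschitzWith.of_le_add fun x y => max_le ?_ ?_
      · exact add_nonneg (le_max_left _ _) dist_nonneg
      · have h1 := infDist_le_infDist_add_dist (s := K) (x := y) (y := x)
        have h2 := le_max_right 0 (1 - infDist y K)
        rw [dist_comm] at h1
        linarith
    · obtain ⟨z, hz, hd⟩ := hK.exists_infDist_eq_dist hne x
      have h1 := mem_closedBall_zero_iff.1 (hR hz)
      have h2 := norm_sub_norm_le x z
      rw [hd, dist_eq_norm]
      linarith
  refine ⟨R + 1, hf.toProfiles, Set.ext fun x => ?_⟩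
  change 1 ≤ max 0 (1 - infDist x K) ↔ _
  rw [hK.isClosed.mem_iff_infDist_zero hne]
  have := infDist_nonneg (x := x) (s := K)
  constructor
  · intro h
    rcases le_max_iff.1 h with h | h <;> linarith
  · intro h
    rw [h]; simp

variable {ρ : ℝ}

theorem superlevel_eq_iteratedSymmetral {v : ℕ → sphere (0 : EuclideanSpace ℝ (Fin n)) 1}
    {x : ℕ → profiles n ρ} (hx : ∀ m, x (m + 1) = symmetrize ρ (v m) (x m)) {t : ℝ} (ht : 0 < t)
    (m : ℕ) : superlevel (x m).1 t =
      iteratedSymmetral (fun m => (v m : EuclideanSpace ℝ (Fin n))) (superlevel (x 0).1 t) m := by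
  induction m with
  | zero => rfl
  | succ m ih =>
    rw [hx, coe_symmetrize, (x m).2.superlevel_steinerFun (norm_eq_of_mem_sphere _) ht, ih,
      iteratedSymmetral]

theorem superlevel_subset_of_dist_le {f g : profiles n ρ} {s t : ℝ} (h : dist f g ≤ t - s) :
    superlevel f.1 t ⊆ superlevel g.1 s := by
  intro z hz
  have h1 := (f.1.dist_coe_le_dist (g := g.1) z).trans h
  have h2 : t ≤ f.1 z := hz
  rw [Real.dist_eq, abs_le] at h1
  change s ≤ g.1 z
  linarith

theorem eventually_superlevel_subset_cthickening {x : ℕ → profiles n ρ} {G : profiles n ρ}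
    (hG : Tendsto x atTop (𝓝 G)) {t ε : ℝ} (ht : 0 < t) (hε : 0 < ε) :
    ∀ᶠ m in atTop, superlevel (x m).1 t ⊆ cthickening ε (superlevel G.1 t) := by
  obtain ⟨s, -, hst, hs⟩ := G.2.exists_superlevel_subset_thickening ht hε
  filter_upwards [hG.eventually (ball_mem_nhds G (sub_pos.2 hst))] with m hm
  exact (superlevel_subset_of_dist_le (mem_ball.1 hm).le).trans
    (hs.trans (thickening_subset_cthickening _ _))

/-- The parallel volumes of the limit are bounded by those of the symmetrals. A superlevel set of
the `m`-th function at a level slightly below `t` lies in a small parallel set of the `m`-th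
symmetral, and, after further symmetrizations, the superlevel sets at that level contain the limit
set; they have no larger parallel volumes. -/
theorem volume_cthickening_superlevel_le {v : ℕ → sphere (0 : EuclideanSpace ℝ (Fin n)) 1}
    {x : ℕ → profiles n ρ} (hx : ∀ m, x (m + 1) = symmetrize ρ (v m) (x m)) {G : profiles n ρ}
    (hG : Tendsto x atTop (𝓝 G)) {t : ℝ} (ht : 0 < t) (m : ℕ) {δ ε : ℝ} (hδ : 0 ≤ δ)
    (hε : 0 < ε) : volume (cthickening δ (superlevel G.1 t)) ≤
      volume (cthickening (δ + ε) (superlevel (x m).1 t)) := by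
  obtain ⟨s, hs0, hst, hs⟩ := (x m).2.exists_superlevel_subset_thickening ht hε
  obtain ⟨k, hk, hmk⟩ := ((hG.eventually (ball_mem_nhds G (sub_pos.2 hst))).and
    (eventually_ge_atTop m)).exists
  have h1 : superlevel G.1 t ⊆ superlevel (x k).1 s :=
    superlevel_subset_of_dist_le (mem_ball'.1 hk).le
  calc volume (cthickening δ (superlevel G.1 t))
      ≤ volume (cthickening δ (superlevel (x k).1 s)) :=
        measure_mono (cthickening_subset_of_subset _ h1)
    _ ≤ volume (cthickening δ (superlevel (x m).1 s)) := by
        rw [superlevel_eq_iteratedSymmetral hx hs0 k, superlevel_eq_iteratedSymmetral hx hs0 m]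
        exact antitone_volume_cthickening_iteratedSymmetral
          (fun m => norm_eq_of_mem_sphere _) ((x 0).2.isCompact_superlevel hs0) hδ hmk
    _ ≤ _ := measure_mono ((cthickening_subset_of_subset _
        (hs.trans (thickening_subset_cthickening _ _))).trans
          (cthickening_cthickening_subset hδ hε.le _))

end Iterated

theorem theorem6p1 {n : ℕ} (F : Set (EuclideanSpace ℝ (Fin n))) (hFfin : F.Finite)
    (hFsphere : F ⊆ Metric.sphere 0 1)
    (u : ℕ → EuclideanSpace ℝ (Fin n)) (hu : ∀ m, u m ∈ F)
    (K : Set (EuclideanSpace ℝ (Fin n))) (hK : IsCompact K) :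
    (∀ m, IsCompact (iteratedSymmetral u K m)) ∧
    ∃ L : Set (EuclideanSpace ℝ (Fin n)), IsCompact L ∧
      Filter.Tendsto (fun m => Metric.hausdorffEDist (iteratedSymmetral u K m) L)
        Filter.atTop (nhds 0) ∧
      Filter.Tendsto (fun m => MeasureTheory.volume (symmDiff (iteratedSymmetral u K m) L))
        Filter.atTop (nhds 0) ∧
      ∀ v ∈ F, (∃ᶠ m in Filter.atTop, u m = v) →
        (Submodule.span ℝ {v})ᗮ.reflection '' L = L := by
  have hu1 : ∀ m, ‖u m‖ = 1 := fun m => mem_sphere_zero_iff_norm.1 (hFsphere (hu m))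
  have hcpt := isCompact_iteratedSymmetral hu1 hK
  refine ⟨hcpt, ?_⟩
  rcases K.eq_empty_or_nonempty with rfl | hne
  · exact ⟨∅, isCompact_empty, by simp [iteratedSymmetral_empty],
      by simp [iteratedSymmetral_empty], by simp⟩
  obtain ⟨ρ, f, hf⟩ := exists_profile hK hne
  let v : ℕ → sphere (0 : EuclideanSpace ℝ (Fin n)) 1 := fun m => ⟨u m, hFsphere (hu m)⟩
  let x : ℕ → profiles n ρ := fun m => Nat.rec f (fun m g => symmetrize ρ (v m) g) m
  have hx : ∀ m, x (m + 1) = symmetrize ρ (v m) (x m) := fun m => rfl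
  obtain ⟨G, hG, hfix⟩ := exists_tendsto_symmetrize hFfin (v := v) hu hx
  have hxK : ∀ m, superlevel (x m).1 1 = iteratedSymmetral u K m := fun m => by
    rw [superlevel_eq_iteratedSymmetral hx one_pos m]
    exact congrArg (fun A => iteratedSymmetral u A m) hf
  have hL := G.2.isCompact_superlevel one_pos
  have hsub : ∀ ε > 0, ∀ᶠ m in atTop,
      iteratedSymmetral u K m ⊆ cthickening ε (superlevel G.1 1) := fun ε hε => by
    simpa only [hxK] using eventually_superlevel_subset_cthickening hG one_pos hε
  have hvol : ∀ m, ∀ δ ≥ 0, ∀ ε > 0, volume (cthickening δ (superlevel G.1 1)) ≤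
      volume (cthickening (δ + ε) (iteratedSymmetral u K m)) := fun m δ hδ ε hε => by
    simpa only [hxK] using volume_cthickening_superlevel_le hx hG one_pos m hδ hε
  refine ⟨superlevel G.1 1, hL, tendsto_hausdorffEDist hL hsub hvol,
    tendsto_volume_symmDiff hL hcpt hsub fun m => volume_le_of_cthickening hL (hcpt m) (hvol m),
    fun w hw hfreq => ?_⟩
  have hw1 : ‖w‖ = 1 := mem_sphere_zero_iff_norm.1 (hFsphere hw)
  have hGw := hfix ⟨w, hFsphere hw⟩ (hfreq.mono fun m hm => Subtype.ext hm)
  have hLw : steinerSymmetral w (superlevel G.1 1) = superlevel G.1 1 := by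
    rw [← G.2.superlevel_steinerFun hw1 one_pos]
    exact congrArg (fun g : profiles n ρ => superlevel g.1 1) hGw
  rw [← hLw]
  exact reflection_image_steinerSymmetral
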